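/- Fix a set $V$ of propositional variables. \textbf{Formulas.} Classical formulas are built from literals $p,p^{\bot}$ ($p\in V$) with $\otimes,\parr,\&,\oplus,!,?$ and the constants $\mathbf 1,\bot,\top,\mathbf 0$; the dual $A^{\bot}$ of a classical formula is defined by de Morgan duality ($\otimes/\parr$, $\&/\oplus$, $!/?$, $\mathbf 1/\bot$, $\top/\mathbf 0$, $p/p^{\bot}$). Intuitionistic formulas are built from variables $p\in V$ with $\otimes,\multimap,\&,\oplus,!$ and the constants $\mathbf 1,\top,\mathbf 0$. Below $\Gamma,\Delta$ are finite multisets of formulas, $\Gamma,\Delta$ is their multiset sum, and $!\Gamma$, $?\Gamma$ are obtained by prefixing every member with $!$, resp. $?$. \textbf{Classical calculi.} $\mathbf{LLW}$ (classical affine logic) derives sequents $\vdash\Gamma$ of classical formulas by the axioms $\vdash A,A^{\bot}$; $\vdash\mathbf 1$; $\vdash\Gamma,\top$; and the following rules: \begin{itemize} \item from $\vdash\Gamma,A$ and $\vdash A^{\bot},\Delta$ infer $\vdash\Gamma,\Delta$ (Cut); \item from $\vdash\Gamma$ infer $\vdash\Gamma,\bot$; \item from $\vdash\Gamma,A$ and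 $\vdash\Delta,B$ infer $\vdash\Gamma,\Delta,A\otimes B$; \item from $\vdash\Gamma,A,B$ infer $\vdash\Gamma,A\parr B$; \item from $\vdash\Gamma,A$ and $\vdash\Gamma,B$ infer $\vdash\Gamma,A\& B$; \item from $\vdash\Gamma,A$ or from $\vdash\Gamma,B$ infer $\vdash\Gamma,A\oplus B$; \item from $\vdash\Gamma$ infer $\vdash\Gamma,A$ (weakening); \item from $\vdash\Gamma,?A,?A$ infer $\vdash\Gamma,?A$ (contraction); \item from $\vdash\Gamma,A$ infer $\vdash\Gamma,?A$ (dereliction); \item from $\vdash{?\Gamma},A$ infer $\vdash{?\Gamma},!A$ (promotion). \end{itemize} $\mathbf{ELLW}$ (classical elementary affine logic) is $\mathbf{LLW}$ with dereliction and promotion replaced by the single rule: from $\vdash\Gamma,A$ infer $\vdash{?\Gamma},!A$. \textbf{Intuitionistic calculi.} $\mathbf{ILLW}$ (intuitionistic affine logic) derives sequents $\Gamma\vdash C$ of intuitionistic formulas, with exactly one formula on the right, by the axioms $A\vdash A$; $\vdash\mathbf 1$; $\Gamma\vdash\top$; $\mathbf 0,\Gamma\vdash C$; and the following rules: \begin{itemize}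 \item from $\Gamma\vdash A$ and $A,\Delta\vdash C$ infer $\Gamma,\Delta\vdash C$ (Cut); \item from $\Gamma\vdash C$ infer $\mathbf 1,\Gamma\vdash C$; \item from $\Gamma\vdash A$ and $B,\Delta\vdash C$ infer $A\multimap B,\Gamma,\Delta\vdash C$; \item from $A,\Gamma\vdash B$ infer $\Gamma\vdash A\multimap B$; \item from $A,B,\Gamma\vdash C$ infer $A\otimes B,\Gamma\vdash C$; \item from $\Gamma\vdash A$ and $\Delta\vdash B$ infer $\Gamma,\Delta\vdash A\otimes B$; \item from $A,\Gamma\vdash C$ or from $B,\Gamma\vdash C$ infer $A\& B,\Gamma\vdash C$; \item from $\Gamma\vdash A$ and $\Gamma\vdash B$ infer $\Gamma\vdash A\& B$; \item from $A,\Gamma\vdash C$ and $B,\Gamma\vdash C$ infer $A\oplus B,\Gamma\vdash C$; \item from $\Gamma\vdash A$ or from $\Gamma\vdash B$ infer $\Gamma\vdash A\oplus B$; \item from $\Gamma\vdash C$ infer $A,\Gamma\vdash C$ (weakening); \item from $!A,!A,\Gamma\vdash C$ infer $!A,\Gamma\vdash C$ (contraction); \item from $A,\Gamma\vdash C$ infer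 $!A,\Gamma\vdash C$ (dereliction); \item from $!\Gamma\vdash A$ infer $!\Gamma\vdash{!A}$ (promotion). \end{itemize} $\mathbf{IELW}$ (intuitionistic elementary affine logic) is $\mathbf{ILLW}$ with dereliction and promotion replaced by the single rule: from $\Gamma\vdash A$ infer $!\Gamma\vdash{!A}$. \textbf{Translation.} For an intuitionistic formula $F$ write $\neg_F A:=A\multimap F$. The parametric negative translation sends a classical formula $A$ to the intuitionistic formula $A^{[F]}$ defined inductively by \begin{align*} p^{[F]}&:=\neg_F p, & (p^{\bot})^{[F]}&:=p,\\ \mathbf 1^{[F]}&:=\neg_F\mathbf 1, & \bot^{[F]}&:=\mathbf 1,\\ \top^{[F]}&:=\mathbf 0, & \mathbf 0^{[F]}&:=\neg_F\mathbf 0,\\ (B\otimes C)^{[F]}&:=\neg_F B^{[F]}\multimap C^{[F]}, & (B\parr C)^{[F]}&:=\neg_F(B^{[F]}\multimap\neg_F C^{[F]}),\\ (B\& C)^{[F]}&:=B^{[F]}\oplus C^{[F]}, & (B\oplus C)^{[F]}&:=\neg_F(\neg_F B^{[F]}\oplus\neg_F C^{[F]}),\\ (!B)^{[F]}&:=\neg_F{!\neg_F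 B^{[F]}}, & (?B)^{[F]}&:={!B^{[F]}}. \end{align*} For a multiset $\Gamma$, $\Gamma^{[F]}$ is obtained by translating every member. \textbf{Theorem.} Let $\Gamma$ be a finite multiset of classical formulas and let $x\in V$ be a propositional variable not occurring in $\Gamma$ (neither as $x$ nor as $x^{\bot}$). Then \begin{enumerate} \item $\vdash\Gamma$ is provable in $\mathbf{LLW}$ if and only if $\Gamma^{[x]}\vdash x$ is provable in $\mathbf{ILLW}$; \item $\vdash\Gamma$ is provable in $\mathbf{ELLW}$ if and only if $\Gamma^{[x]}\vdash x$ is provable in $\mathbf{IELW}$. \end{enumerate} -/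

import Mathlib

universe u

namespace AffineLogic

/-- Classical formulas, built from the literals `p`, `p^⊥` (`p` a propositional variable in `V`)
by `⊗, ⅋, &, ⊕, !, ?` and the constants `1, ⊥, ⊤, 0`. Negation is not a connective; see
`CFormula.dual`. -/
inductive CFormula (V : Type u) : Type u
  | pos (p : V)
  | neg (p : V)
  | one
  | bot
  | top
  | zero
  | tensor (A B : CFormula V)
  | par (A B : CFormula V)
  | with' (A B : CFormula V)
  | plus (A B : CFormula V)
  | bang (A : CFormula V)
  | quest (A : CFormula V)

/-- Intuitionistic formulas of the bottom-free language, built from propositional variables by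
`⊗, ⊸, &, ⊕, !` and the constants `1, ⊤, 0`. -/
inductive IFormula (V : Type u) : Type u
  | var (p : V)
  | one
  | top
  | zero
  | tensor (A B : IFormula V)
  | lolli (A B : IFormula V)
  | with' (A B : IFormula V)
  | plus (A B : IFormula V)
  | bang (A : IFormula V)

variable {V : Type u}

/-- The de Morgan dual `A^⊥`. -/
def CFormula.dual : CFormula V → CFormula V
  | .pos p => .neg p
  | .neg p => .pos p
  | .one => .bot
  | .bot => .one
  | .top => .zero
  | .zero => .top
  | .tensor A B => .par A.dual B.dual
  | .par A B => .tensor A.dual B.dual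
  | .with' A B => .plus A.dual B.dual
  | .plus A B => .with' A.dual B.dual
  | .bang A => .quest A.dual
  | .quest A => .bang A.dual

/-- The propositional variable `x` occurs in the formula, in a literal `x` or `x^⊥`. -/
def CFormula.Occurs (x : V) : CFormula V → Prop
  | .pos p => p = x
  | .neg p => p = x
  | .one => False
  | .bot => False
  | .top => False
  | .zero => False
  | .tensor A B => A.Occurs x ∨ B.Occurs x
  | .par A B => A.Occurs x ∨ B.Occurs x
  | .with' A B => A.Occurs x ∨ B.Occurs x
  | .plus A B => A.Occurs x ∨ B.Occurs x
  | .bang A => A.Occurs x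
  | .quest A => A.Occurs x

/-- The two disciplines for the exponentials: the usual one (dereliction and promotion) and the
elementary one (functorial promotion only). -/
inductive Discipline : Type
  | usual
  | elementary

/-- Derivability of one-sided sequents `⊢ Γ` in classical affine logic, with either discipline
for the exponentials. -/
inductive CProvable : Discipline → Multiset (CFormula V) → Prop
  | init {d} (A : CFormula V) : CProvable d {A, A.dual}
  | cut {d} {Γ Δ : Multiset (CFormula V)} {A : CFormula V} :
      CProvable d (A ::ₘ Γ) → CProvable d (A.dual ::ₘ Δ) → CProvable d (Γ + Δ)
  | one {d} : CProvable d {CFormula.one}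
  | top {d} (Γ : Multiset (CFormula V)) : CProvable d (CFormula.top ::ₘ Γ)
  | bot {d} {Γ : Multiset (CFormula V)} : CProvable d Γ → CProvable d (CFormula.bot ::ₘ Γ)
  | tensor {d} {Γ Δ : Multiset (CFormula V)} {A B : CFormula V} :
      CProvable d (A ::ₘ Γ) → CProvable d (B ::ₘ Δ) →
      CProvable d (A.tensor B ::ₘ (Γ + Δ))
  | par {d} {Γ : Multiset (CFormula V)} {A B : CFormula V} :
      CProvable d (A ::ₘ B ::ₘ Γ) → CProvable d (A.par B ::ₘ Γ)
  | with' {d} {Γ : Multiset (CFormula V)} {A B : CFormula V} :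
      CProvable d (A ::ₘ Γ) → CProvable d (B ::ₘ Γ) → CProvable d (A.with' B ::ₘ Γ)
  | plus₁ {d} {Γ : Multiset (CFormula V)} {A B : CFormula V} :
      CProvable d (A ::ₘ Γ) → CProvable d (A.plus B ::ₘ Γ)
  | plus₂ {d} {Γ : Multiset (CFormula V)} {A B : CFormula V} :
      CProvable d (B ::ₘ Γ) → CProvable d (A.plus B ::ₘ Γ)
  | weakening {d} {Γ : Multiset (CFormula V)} {A : CFormula V} :
      CProvable d Γ → CProvable d (A ::ₘ Γ)
  | contraction {d} {Γ : Multiset (CFormula V)} {A : CFormula V} :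
      CProvable d (A.quest ::ₘ A.quest ::ₘ Γ) → CProvable d (A.quest ::ₘ Γ)
  | dereliction {Γ : Multiset (CFormula V)} {A : CFormula V} :
      CProvable .usual (A ::ₘ Γ) → CProvable .usual (A.quest ::ₘ Γ)
  | promotion {Γ : Multiset (CFormula V)} {A : CFormula V} :
      CProvable .usual (A ::ₘ Γ.map CFormula.quest) →
      CProvable .usual (A.bang ::ₘ Γ.map CFormula.quest)
  | functorial {Γ : Multiset (CFormula V)} {A : CFormula V} :
      CProvable .elementary (A ::ₘ Γ) →
      CProvable .elementary (A.bang ::ₘ Γ.map CFormula.quest)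

/-- Derivability of two-sided sequents `Γ ⊢ C` in (bottom-free) intuitionistic affine logic, with
either discipline for the exponentials. -/
inductive IProvable : Discipline → Multiset (IFormula V) → IFormula V → Prop
  | init {d} (A : IFormula V) : IProvable d {A} A
  | cut {d} {Γ Δ : Multiset (IFormula V)} {A C : IFormula V} :
      IProvable d Γ A → IProvable d (A ::ₘ Δ) C → IProvable d (Γ + Δ) C
  | oneR {d} : IProvable d 0 IFormula.one
  | oneL {d} {Γ : Multiset (IFormula V)} {C : IFormula V} :
      IProvable d Γ C → IProvable d (IFormula.one ::ₘ Γ) C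
  | topR {d} (Γ : Multiset (IFormula V)) : IProvable d Γ IFormula.top
  | zeroL {d} (Γ : Multiset (IFormula V)) (C : IFormula V) :
      IProvable d (IFormula.zero ::ₘ Γ) C
  | lolliL {d} {Γ Δ : Multiset (IFormula V)} {A B C : IFormula V} :
      IProvable d Γ A → IProvable d (B ::ₘ Δ) C → IProvable d (A.lolli B ::ₘ (Γ + Δ)) C
  | lolliR {d} {Γ : Multiset (IFormula V)} {A B : IFormula V} :
      IProvable d (A ::ₘ Γ) B → IProvable d Γ (A.lolli B)
  | tensorL {d} {Γ : Multiset (IFormula V)} {A B C : IFormula V} :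
      IProvable d (A ::ₘ B ::ₘ Γ) C → IProvable d (A.tensor B ::ₘ Γ) C
  | tensorR {d} {Γ Δ : Multiset (IFormula V)} {A B : IFormula V} :
      IProvable d Γ A → IProvable d Δ B → IProvable d (Γ + Δ) (A.tensor B)
  | withL₁ {d} {Γ : Multiset (IFormula V)} {A B C : IFormula V} :
      IProvable d (A ::ₘ Γ) C → IProvable d (A.with' B ::ₘ Γ) C
  | withL₂ {d} {Γ : Multiset (IFormula V)} {A B C : IFormula V} :
      IProvable d (B ::ₘ Γ) C → IProvable d (A.with' B ::ₘ Γ) C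
  | withR {d} {Γ : Multiset (IFormula V)} {A B : IFormula V} :
      IProvable d Γ A → IProvable d Γ B → IProvable d Γ (A.with' B)
  | plusL {d} {Γ : Multiset (IFormula V)} {A B C : IFormula V} :
      IProvable d (A ::ₘ Γ) C → IProvable d (B ::ₘ Γ) C → IProvable d (A.plus B ::ₘ Γ) C
  | plusR₁ {d} {Γ : Multiset (IFormula V)} {A B : IFormula V} :
      IProvable d Γ A → IProvable d Γ (A.plus B)
  | plusR₂ {d} {Γ : Multiset (IFormula V)} {A B : IFormula V} :
      IProvable d Γ B → IProvable d Γ (A.plus B)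
  | weakening {d} {Γ : Multiset (IFormula V)} {A C : IFormula V} :
      IProvable d Γ C → IProvable d (A ::ₘ Γ) C
  | contraction {d} {Γ : Multiset (IFormula V)} {A C : IFormula V} :
      IProvable d (A.bang ::ₘ A.bang ::ₘ Γ) C → IProvable d (A.bang ::ₘ Γ) C
  | dereliction {Γ : Multiset (IFormula V)} {A C : IFormula V} :
      IProvable .usual (A ::ₘ Γ) C → IProvable .usual (A.bang ::ₘ Γ) C
  | promotion {Γ : Multiset (IFormula V)} {A : IFormula V} :
      IProvable .usual (Γ.map IFormula.bang) A →
      IProvable .usual (Γ.map IFormula.bang) A.bang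
  | functorial {Γ : Multiset (IFormula V)} {A : IFormula V} :
      IProvable .elementary Γ A → IProvable .elementary (Γ.map IFormula.bang) A.bang

/-- Provability of `⊢ Γ` in classical affine logic **LLW**. -/
def LLW (Γ : Multiset (CFormula V)) : Prop := CProvable .usual Γ

/-- Provability of `⊢ Γ` in classical elementary affine logic **ELLW**. -/
def ELLW (Γ : Multiset (CFormula V)) : Prop := CProvable .elementary Γ

/-- Provability of `Γ ⊢ C` in intuitionistic affine logic **ILLW**. -/
def ILLW (Γ : Multiset (IFormula V)) (C : IFormula V) : Prop := IProvable .usual Γ C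

/-- Provability of `Γ ⊢ C` in intuitionistic elementary affine logic **IELW**. -/
def IELW (Γ : Multiset (IFormula V)) (C : IFormula V) : Prop := IProvable .elementary Γ C

/-- The parametric negation `¬_F A := A ⊸ F`. -/
def IFormula.negRel (F A : IFormula V) : IFormula V := A.lolli F

/-- The parametric negative translation `A^[F]` of a classical formula `A`. -/
def CFormula.trans (F : IFormula V) : CFormula V → IFormula V
  | .pos p => F.negRel (.var p)
  | .neg p => .var p
  | .one => F.negRel .one
  | .bot => .one
  | .top => .zero
  | .zero => F.negRel .zero
  | .tensor B C => (F.negRel (B.trans F)).lolli (C.trans F)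
  | .par B C => F.negRel ((B.trans F).lolli (F.negRel (C.trans F)))
  | .with' B C => (B.trans F).plus (C.trans F)
  | .plus B C => F.negRel ((F.negRel (B.trans F)).plus (F.negRel (C.trans F)))
  | .bang B => F.negRel (F.negRel (B.trans F)).bang
  | .quest B => (B.trans F).bang

end AffineLogic

namespace AffineLogic

open scoped Pointwise

universe v

variable {V : Type v} {d : Discipline}

/-! Forward direction: after translation every cut-free classical rule, with axioms on literals
only, is simulated by intuitionistic rules acting on the left with `F` as conclusion
(`cutFreeClosed_trans`). Cut is the exception, because both translated cut formulas stand on the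
left. It is therefore eliminated, semantically and for both disciplines at once: any set `P` of
sequents closed under the cut-free rules is the pole of a phase space on the monoid of multisets.
Soundness (`CutFreeClosed.interpSeq_subset`) holds for all rules including cut, and `A` as a
one-element multiset lies in the orthogonal of its own interpretation, so every provable sequent
belongs to `P` (`CutFreeClosed.mem_of_provable`). Taking for `P` the sequents whose translation is
derivable gives the claim.

Backward direction: read intuitionistic derivations classically with `⊥` in place of `x`. Then `A ⊸
x` becomes `A^⊥ ⅋ ⊥`, equivalent to `A^⊥`. Hence, when `x` does not occur in `A`, the reading of
`A^[x]` is equivalent to `A^⊥` (`toClassical_trans_equiv`), and cuts restore `Γ`. -/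

theorem CFormula.dual_dual (A : CFormula V) : A.dual.dual = A := by
  induction A <;> simp_all [CFormula.dual]

/-! ### From classical to intuitionistic derivations -/

/-- A set of sequents closed under the cut-free rules of classical affine logic, with the axiom
restricted to literals. -/
structure CutFreeClosed (d : Discipline) (P : Set (Multiset (CFormula V))) : Prop where
  init (p : V) : {CFormula.pos p, CFormula.neg p} ∈ P
  one : {CFormula.one} ∈ P
  top (Γ : Multiset (CFormula V)) : CFormula.top ::ₘ Γ ∈ P
  bot {Γ : Multiset (CFormula V)} : Γ ∈ P → CFormula.bot ::ₘ Γ ∈ P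
  tensor {Γ Δ : Multiset (CFormula V)} {A B : CFormula V} :
    A ::ₘ Γ ∈ P → B ::ₘ Δ ∈ P → A.tensor B ::ₘ (Γ + Δ) ∈ P
  par {Γ : Multiset (CFormula V)} {A B : CFormula V} : A ::ₘ B ::ₘ Γ ∈ P → A.par B ::ₘ Γ ∈ P
  with' {Γ : Multiset (CFormula V)} {A B : CFormula V} :
    A ::ₘ Γ ∈ P → B ::ₘ Γ ∈ P → A.with' B ::ₘ Γ ∈ P
  plus₁ {Γ : Multiset (CFormula V)} {A B : CFormula V} : A ::ₘ Γ ∈ P → A.plus B ::ₘ Γ ∈ P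
  plus₂ {Γ : Multiset (CFormula V)} {A B : CFormula V} : B ::ₘ Γ ∈ P → A.plus B ::ₘ Γ ∈ P
  weakening {Γ : Multiset (CFormula V)} {A : CFormula V} : Γ ∈ P → A ::ₘ Γ ∈ P
  contraction {Γ : Multiset (CFormula V)} {A : CFormula V} :
    A.quest ::ₘ A.quest ::ₘ Γ ∈ P → A.quest ::ₘ Γ ∈ P
  dereliction {Γ : Multiset (CFormula V)} {A : CFormula V} :
    d = .usual → A ::ₘ Γ ∈ P → A.quest ::ₘ Γ ∈ P
  promotion {Γ : Multiset (CFormula V)} {A : CFormula V} :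
    d = .usual → A ::ₘ Γ.map CFormula.quest ∈ P →
    A.bang ::ₘ Γ.map CFormula.quest ∈ P
  functorial {Γ : Multiset (CFormula V)} {A : CFormula V} :
    d = .elementary → A ::ₘ Γ ∈ P → A.bang ::ₘ Γ.map CFormula.quest ∈ P

/-! ### Orthogonality in a commutative monoid with a pole. -/

section Phase

variable {M : Type*} [AddCommMonoid M] {P X Y Z : Set M}

/-- The orthogonal of a set of elements of a phase space with pole `P`. -/
def orth (P X : Set M) : Set M := {m | ∀ n ∈ X, m + n ∈ P}

theorem orth_anti (h : X ⊆ Y) : orth P Y ⊆ orth P X := fun _ hm n hn => hm n (h hn)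

theorem subset_orth_orth : X ⊆ orth P (orth P X) := fun m hm n hn => by
  rw [add_comm]; exact hn m hm

theorem orth_orth_orth : orth P (orth P (orth P X)) = orth P X :=
  (orth_anti subset_orth_orth).antisymm subset_orth_orth

theorem add_subset_iff_subset_orth : X + Y ⊆ P ↔ X ⊆ orth P Y :=
  Set.add_subset_iff

theorem orth_orth_add_subset_iff : orth P (orth P X) + Y ⊆ P ↔ X + Y ⊆ P := by
  rw [add_comm, add_subset_iff_subset_orth, orth_orth_orth, ← add_subset_iff_subset_orth, add_comm]

theorem orth_union : orth P (X ∪ Y) = orth P X ∩ orth P Y := by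
  ext m; simp [orth, or_imp, forall_and]

/-- Inclusion in the pole can be tested on generators, one summand at a time. In the promotion rules
this reduces a context of `?`-formulas to sequents of the form `?Θ`. -/
theorem multiset_sum_orth_orth_add_subset {ι : Type*} (s : Multiset ι) (f : ι → Set M)
    (h : (s.map f).sum + Y ⊆ P) : (s.map fun i => orth P (orth P (f i))).sum + Y ⊆ P := by
  induction s using Multiset.induction_on generalizing Y with
  | empty => simpa using h
  | cons i s ih =>
    rw [Multiset.map_cons, Multiset.sum_cons, add_assoc] at h ⊢
    rw [orth_orth_add_subset_iff, add_left_comm]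
    exact ih (by rwa [add_left_comm])

end Phase

/-! ### Phase semantics of classical formulas. -/

/-- The sequents `?Θ` that interpret `!A` when `X` interprets `A`. -/
def expGen : Discipline → Set (Multiset (CFormula V)) → Set (Multiset (CFormula V))
  | .usual, X => {Γ | ∃ Θ : Multiset (CFormula V), Γ = Θ.map CFormula.quest ∧ Γ ∈ X}
  | .elementary, X => {Γ | ∃ Θ : Multiset (CFormula V), Γ = Θ.map CFormula.quest ∧ Θ ∈ X}

/-- The interpretation of a formula in the phase space of sequents with pole `P`. -/
def interp (d : Discipline) (P : Set (Multiset (CFormula V))) :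
    CFormula V → Set (Multiset (CFormula V))
  | .pos p => orth P {{CFormula.pos p}}
  | .neg p => orth P (orth P {{CFormula.pos p}})
  | .one => orth P (orth P {0})
  | .bot => orth P {0}
  | .top => orth P ∅
  | .zero => orth P (orth P ∅)
  | .tensor A B => orth P (orth P (interp d P A + interp d P B))
  | .par A B => orth P (orth P (interp d P A) + orth P (interp d P B))
  | .with' A B => orth P (orth P (interp d P A) ∪ orth P (interp d P B))
  | .plus A B => orth P (orth P (interp d P A ∪ interp d P B))
  | .bang A => orth P (orth P (expGen d (interp d P A)))
  | .quest A => orth P (expGen d (orth P (interp d P A)))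

variable {P : Set (Multiset (CFormula V))}

theorem orth_orth_interp (A : CFormula V) : orth P (orth P (interp d P A)) = interp d P A := by
  cases A <;> exact orth_orth_orth

theorem interp_dual (A : CFormula V) : interp d P A.dual = orth P (interp d P A) := by
  induction A with
  | par A B ihA ihB => simp only [CFormula.dual, interp, ihA, ihB]
  | with' A B ihA ihB => simp only [CFormula.dual, interp, ihA, ihB]
  | quest A ih => simp only [CFormula.dual, interp, ih]
  | tensor A B ihA ihB =>
    simp only [CFormula.dual, interp, ihA, ihB, orth_orth_interp, orth_orth_orth]
  | plus A B ihA ihB =>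
    simp only [CFormula.dual, interp, ihA, ihB, orth_orth_interp, orth_orth_orth]
  | bang A ih => simp only [CFormula.dual, interp, ih, orth_orth_interp, orth_orth_orth]
  | _ => simp only [CFormula.dual, interp, orth_orth_orth]

theorem mem_interp_with {A B : CFormula V} {Γ : Multiset (CFormula V)} :
    Γ ∈ interp d P (A.with' B) ↔ Γ ∈ interp d P A ∧ Γ ∈ interp d P B := by
  simp only [interp, orth_union, orth_orth_interp, Set.mem_inter_iff]

/-- Okada's lemma: every context `Γ` in the interpretation of `A` makes `A, Γ` a member of the pole.
Each connective uses exactly its own cut-free introduction rule, which is what makes cut elimination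
possible without inspecting derivations. -/
theorem CutFreeClosed.singleton_mem_orth_interp (hP : CutFreeClosed d P) (A : CFormula V) :
    {A} ∈ orth P (interp d P A) := by
  -- When the interpretation is a biorthogonal, only its generators have to be checked.
  have key : ∀ {A : CFormula V} {X : Set (Multiset (CFormula V))},
      (∀ Γ ∈ X, A ::ₘ Γ ∈ P) → {A} ∈ orth P (orth P (orth P X)) := fun h =>
    subset_orth_orth fun Γ hΓ => by simpa using h Γ hΓ
  induction A with
  | pos p => exact subset_orth_orth (Set.mem_singleton _)
  | neg p =>
    refine key ?_
    rintro _ rfl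
    exact Multiset.cons_swap _ _ _ ▸ hP.init p
  | one => exact key (by simpa using hP.one)
  | bot => intro Γ hΓ; simpa using hP.bot (by simpa using hΓ 0 rfl)
  | top => intro Γ hΓ; simpa using hP.top Γ
  | zero => exact key (by simp)
  | tensor A B ihA ihB =>
    refine key ?_
    rintro _ ⟨Γ, hΓ, Δ, hΔ, rfl⟩
    exact hP.tensor (by simpa using ihA Γ hΓ) (by simpa using ihB Δ hΔ)
  | par A B ihA ihB =>
    intro Γ hΓ
    have h := hΓ _ (Set.add_mem_add ihA ihB)
    rw [add_comm, add_assoc] at h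
    exact hP.par (Multiset.cons_swap _ _ _ ▸ by simpa using h)
  | with' A B ihA ihB =>
    intro Γ hΓ
    rw [mem_interp_with] at hΓ
    exact hP.with' (by simpa using ihA Γ hΓ.1) (by simpa using ihB Γ hΓ.2)
  | plus A B ihA ihB =>
    refine key ?_
    rintro Γ (h | h)
    · exact hP.plus₁ (by simpa using ihA Γ h)
    · exact hP.plus₂ (by simpa using ihB Γ h)
  | bang A ih =>
    refine key ?_
    cases d
    · rintro _ ⟨Θ, rfl, h⟩
      exact hP.promotion rfl (by simpa using ih _ h)
    · rintro _ ⟨Θ, rfl, h⟩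
      exact hP.functorial rfl (by simpa using ih _ h)
  | quest A ih =>
    refine subset_orth_orth ?_
    cases d
    · refine ⟨{A}, by simp, fun Γ hΓ => ?_⟩
      exact hP.dereliction rfl (by simpa using ih Γ hΓ)
    -- In the elementary case membership concerns the sequent stripped of `?`, so the induction
    -- hypothesis suffices without dereliction.
    · exact ⟨{A}, by simp, ih⟩

theorem CutFreeClosed.weakening_add (hP : CutFreeClosed d P) {Γ : Multiset (CFormula V)}
    (Δ : Multiset (CFormula V)) (h : Γ ∈ P) : Δ + Γ ∈ P := by
  induction Δ using Multiset.induction_on with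
  | empty => simpa using h
  | cons A Δ ih => rw [Multiset.cons_add]; exact hP.weakening ih

theorem CutFreeClosed.contraction_add (hP : CutFreeClosed d P) {Γ : Multiset (CFormula V)}
    (Θ : Multiset (CFormula V)) (h : Θ.map CFormula.quest + (Θ.map CFormula.quest + Γ) ∈ P) :
    Θ.map CFormula.quest + Γ ∈ P := by
  induction Θ using Multiset.induction_on generalizing Γ with
  | empty => simpa using h
  | cons A Θ ih =>
    rw [Multiset.map_cons, Multiset.cons_add]
    apply hP.contraction
    have := @ih (A.quest ::ₘ A.quest ::ₘ Γ) (by simpa using h)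
    simpa using this

theorem expGen_usual_sum_subset (s : Multiset (CFormula V))
    (f : CFormula V → Set (Multiset (CFormula V))) {Γ : Multiset (CFormula V)}
    (h : Γ ∈ (s.map fun A => expGen .usual (f A)).sum) :
    ∃ Θ : Multiset (CFormula V), Γ = Θ.map CFormula.quest := by
  induction s using Multiset.induction_on generalizing Γ with
  | empty => exact ⟨0, by simpa using h⟩
  | cons A s ih =>
    rw [Multiset.map_cons, Multiset.sum_cons] at h
    obtain ⟨_, ⟨Θ, rfl, -⟩, _, h, rfl⟩ := h
    obtain ⟨Θ', rfl⟩ := ih h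
    exact ⟨Θ + Θ', by simp⟩

theorem expGen_elementary_sum_subset (s : Multiset (CFormula V))
    (f : CFormula V → Set (Multiset (CFormula V))) {Γ : Multiset (CFormula V)}
    (h : Γ ∈ (s.map fun A => expGen .elementary (f A)).sum) :
    ∃ Θ : Multiset (CFormula V), Γ = Θ.map CFormula.quest ∧ Θ ∈ (s.map f).sum := by
  induction s using Multiset.induction_on generalizing Γ with
  | empty => exact ⟨0, by simpa using h⟩
  | cons A s ih =>
    rw [Multiset.map_cons, Multiset.sum_cons] at h
    obtain ⟨_, ⟨Θ, rfl, hΘ⟩, _, h, rfl⟩ := h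
    obtain ⟨Θ', rfl, hΘ'⟩ := ih h
    exact ⟨Θ + Θ', by simp, by
      rw [Multiset.map_cons, Multiset.sum_cons]; exact Set.add_mem_add hΘ hΘ'⟩

/-! ### Soundness of the phase semantics and cut elimination. -/

/-- The interpretation of a sequent, as a sum of the orthogonals of its formulas. -/
def interpSeq (d : Discipline) (P : Set (Multiset (CFormula V))) (Γ : Multiset (CFormula V)) :
    Set (Multiset (CFormula V)) :=
  (Γ.map fun A => orth P (interp d P A)).sum

@[simp] theorem interpSeq_cons (A : CFormula V) (Γ : Multiset (CFormula V)) :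
    interpSeq d P (A ::ₘ Γ) = orth P (interp d P A) + interpSeq d P Γ := by
  simp [interpSeq]

@[simp] theorem interpSeq_add (Γ Δ : Multiset (CFormula V)) :
    interpSeq d P (Γ + Δ) = interpSeq d P Γ + interpSeq d P Δ := by
  simp [interpSeq]

/-- Interpretations are biorthogonally closed, so any formula can be singled out as a conclusion
with the others as hypotheses. -/
theorem interpSeq_cons_subset_iff {A : CFormula V} {Γ : Multiset (CFormula V)} :
    interpSeq d P (A ::ₘ Γ) ⊆ P ↔ interpSeq d P Γ ⊆ interp d P A := by
  rw [interpSeq_cons, add_comm, add_subset_iff_subset_orth, orth_orth_interp]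

theorem interpSeq_map_quest (Γ : Multiset (CFormula V)) :
    interpSeq d P (Γ.map CFormula.quest) =
      (Γ.map fun A => orth P (orth P (expGen d (orth P (interp d P A))))).sum := by
  rw [interpSeq, Multiset.map_map]; rfl

/-- The logical rules follow from orthogonality alone; closure of `P` is needed only for the
structural rules. Cut amounts to `interp_dual` together with antitonicity of `orth`, and the axiom
on arbitrary formulas comes for free. -/
theorem CutFreeClosed.interpSeq_subset (hP : CutFreeClosed d P) {Γ : Multiset (CFormula V)}
    (h : CProvable d Γ) : interpSeq d P Γ ⊆ P := by
  induction h with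
  | init A =>
    rw [Multiset.insert_eq_cons, interpSeq_cons_subset_iff]
    simp [interpSeq, interp_dual, orth_orth_interp]
  | @cut _ Γ Δ A _ _ ih₁ ih₂ =>
    have ih₁ := interpSeq_cons_subset_iff.1 (ih₁ hP)
    have ih₂ := interpSeq_cons_subset_iff.1 (ih₂ hP)
    rw [interp_dual] at ih₂
    rw [interpSeq_add, add_comm, add_subset_iff_subset_orth]
    exact ih₂.trans (orth_anti ih₁)
  | one =>
    rw [← Multiset.cons_zero, interpSeq_cons_subset_iff]
    simpa [interpSeq, interp] using subset_orth_orth (P := P) (X := {0}) rfl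
  | top Γ =>
    rw [interpSeq_cons_subset_iff]
    intro Γ _; simp [interp, orth]
  | bot _ ih =>
    rw [interpSeq_cons_subset_iff]
    intro Γ h; simpa [interp, orth] using ih hP h
  | tensor _ _ ih₁ ih₂ =>
    have ih₁ := interpSeq_cons_subset_iff.1 (ih₁ hP)
    have ih₂ := interpSeq_cons_subset_iff.1 (ih₂ hP)
    rw [interpSeq_cons_subset_iff, interpSeq_add]
    exact (Set.add_subset_add ih₁ ih₂).trans subset_orth_orth
  | par _ ih =>
    have ih := ih hP
    rw [interpSeq_cons_subset_iff, interp, ← add_subset_iff_subset_orth]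
    rwa [interpSeq_cons, interpSeq_cons, ← add_assoc, add_comm] at ih
  | with' _ _ ih₁ ih₂ =>
    have ih₁ := interpSeq_cons_subset_iff.1 (ih₁ hP)
    have ih₂ := interpSeq_cons_subset_iff.1 (ih₂ hP)
    rw [interpSeq_cons_subset_iff]
    exact fun Γ h => mem_interp_with.2 ⟨ih₁ h, ih₂ h⟩
  | plus₁ _ ih =>
    have ih := interpSeq_cons_subset_iff.1 (ih hP)
    rw [interpSeq_cons_subset_iff]
    exact ih.trans (Set.subset_union_left.trans subset_orth_orth)
  | plus₂ _ ih =>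
    have ih := interpSeq_cons_subset_iff.1 (ih hP)
    rw [interpSeq_cons_subset_iff]
    exact ih.trans (Set.subset_union_right.trans subset_orth_orth)
  | weakening _ ih =>
    rw [interpSeq_cons]
    rintro _ ⟨Δ, -, Γ, h, rfl⟩
    exact hP.weakening_add Δ (ih hP h)
  | @contraction _ Γ A _ ih =>
    have ih := ih hP
    -- Both copies of `?A` are replaced by generators. Choosing the same `?Θ` for each leaves a
    -- doubled block of `?`-formulas, which the pole can contract.
    rw [interpSeq_cons, interpSeq_cons, interp, orth_orth_add_subset_iff, add_left_comm,
      orth_orth_add_subset_iff] at ih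
    rw [interpSeq_cons, interp, orth_orth_add_subset_iff]
    rintro _ ⟨Θ, hΘ, Δ, hΔ, rfl⟩
    have := ih (Set.add_mem_add hΘ (Set.add_mem_add hΘ hΔ))
    obtain ⟨Θ, rfl⟩ : ∃ Θ' : Multiset (CFormula V), Θ = Θ'.map CFormula.quest := by
      revert hΘ; cases ‹Discipline› <;> rintro ⟨Θ, rfl, -⟩ <;> exact ⟨Θ, rfl⟩
    exact hP.contraction_add Θ this
  | @dereliction Γ A _ ih =>
    have ih := interpSeq_cons_subset_iff.1 (ih hP)
    rw [interpSeq_cons_subset_iff]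
    refine ih.trans ?_
    rw [← orth_orth_interp, interp]
    refine orth_anti ?_
    rintro _ ⟨Θ, -, h⟩
    exact h
  | @promotion Γ A _ ih =>
    have ih := interpSeq_cons_subset_iff.1 (ih hP)
    rw [interpSeq_cons, interp, orth_orth_orth, add_comm, interpSeq_map_quest]
    apply multiset_sum_orth_orth_add_subset
    rw [add_subset_iff_subset_orth]
    intro Δ hΔ
    obtain ⟨Θ, rfl⟩ := expGen_usual_sum_subset _ _ hΔ
    -- The context is now literally `?Θ`, so membership in the interpretation of `A` already makes
    -- it a generator for `!A`.
    refine subset_orth_orth ⟨Θ, rfl, ih ?_⟩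
    rw [interpSeq_map_quest]
    exact Multiset.sum_map_le_sum_map _ _ (fun _ _ => subset_orth_orth) hΔ
  | @functorial Γ A _ ih =>
    have ih := interpSeq_cons_subset_iff.1 (ih hP)
    rw [interpSeq_cons, interp, orth_orth_orth, add_comm, interpSeq_map_quest]
    apply multiset_sum_orth_orth_add_subset
    rw [add_subset_iff_subset_orth]
    intro Δ hΔ
    obtain ⟨Θ, rfl, hΘ⟩ := expGen_elementary_sum_subset _ _ hΔ
    exact subset_orth_orth ⟨Θ, rfl, ih hΘ⟩

/-- Cut elimination: a set of sequents closed under the cut-free rules contains all provable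
sequents. -/
theorem CutFreeClosed.mem_of_provable (hP : CutFreeClosed d P) {Γ : Multiset (CFormula V)}
    (h : CProvable d Γ) : Γ ∈ P := by
  refine hP.interpSeq_subset h ?_
  clear h
  induction Γ using Multiset.induction_on with
  | empty => simp [interpSeq]
  | cons A Γ ih =>
    -- `Γ` is the sum of its one-element multisets, each in the corresponding orthogonal, so `Γ`
    -- belongs to its own interpretation.
    rw [interpSeq_cons, ← Multiset.singleton_add]
    exact Set.add_mem_add (hP.singleton_mem_orth_interp A) ih

theorem IProvable.negRelL {Γ : Multiset (IFormula V)} {F A : IFormula V} (h : IProvable d Γ A) :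
    IProvable d (F.negRel A ::ₘ Γ) F := by
  simpa [IFormula.negRel] using IProvable.lolliL h (IProvable.init (d := d) F)

/-- This holds for every `F`. Where a clause of the translation begins with `¬_F`, the components
are moved to the right by `lolliR`, the intuitionistic right rule is applied, and `negRelL` brings
the result back to the left. The remaining clauses match left rules. -/
theorem cutFreeClosed_trans (d : Discipline) (F : IFormula V) :
    CutFreeClosed d {Γ | IProvable d (Γ.map (CFormula.trans F)) F} where
  init p := by simpa [CFormula.trans] using (IProvable.init _).negRelL
  one := by simpa [CFormula.trans] using IProvable.oneR.negRelL
  top Γ := by simpa [CFormula.trans] using IProvable.zeroL _ _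
  bot h := by simpa [CFormula.trans] using IProvable.oneL h
  tensor {Γ Δ A B} h₁ h₂ := by
    simp only [Set.mem_ofPred_eq, Multiset.map_cons, Multiset.map_add, CFormula.trans] at *
    exact h₁.lolliR.lolliL h₂
  par {Γ A B} h := by
    simp only [Set.mem_ofPred_eq, Multiset.map_cons, CFormula.trans] at *
    rw [Multiset.cons_swap] at h
    exact h.lolliR.lolliR.negRelL
  with' h₁ h₂ := by
    simp only [Set.mem_ofPred_eq, Multiset.map_cons, CFormula.trans] at *
    exact h₁.plusL h₂
  plus₁ h := by
    simp only [Set.mem_ofPred_eq, Multiset.map_cons, CFormula.trans] at *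
    exact h.lolliR.plusR₁.negRelL
  plus₂ h := by
    simp only [Set.mem_ofPred_eq, Multiset.map_cons, CFormula.trans] at *
    exact h.lolliR.plusR₂.negRelL
  weakening h := by
    simp only [Set.mem_ofPred_eq, Multiset.map_cons] at *
    exact h.weakening
  contraction h := by
    simp only [Set.mem_ofPred_eq, Multiset.map_cons, CFormula.trans] at *
    exact h.contraction
  dereliction hd h := by
    subst hd
    simp only [Set.mem_ofPred_eq, Multiset.map_cons, CFormula.trans] at *
    exact h.dereliction
  promotion {Γ A} hd h := by
    subst hd
    have e : (Γ.map CFormula.quest).map (CFormula.trans F) =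
        (Γ.map (CFormula.trans F)).map IFormula.bang := by
      rw [Multiset.map_map, Multiset.map_map]; rfl
    simp only [Set.mem_ofPred_eq, Multiset.map_cons, e] at *
    exact h.lolliR.promotion.negRelL
  functorial {Γ A} hd h := by
    subst hd
    have e : (Γ.map CFormula.quest).map (CFormula.trans F) =
        (Γ.map (CFormula.trans F)).map IFormula.bang := by
      rw [Multiset.map_map, Multiset.map_map]; rfl
    simp only [Set.mem_ofPred_eq, Multiset.map_cons, e] at *
    exact h.lolliR.functorial.negRelL

/-! ### From intuitionistic to classical derivations -/

open Classical in
/-- The classical reading of an intuitionistic formula, with `⊥` substituted for `x`. -/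
noncomputable def IFormula.toClassical (x : V) : IFormula V → CFormula V
  | .var p => if p = x then .bot else .pos p
  | .one => .one
  | .top => .top
  | .zero => .zero
  | .tensor A B => .tensor (A.toClassical x) (B.toClassical x)
  | .lolli A B => .par (A.toClassical x).dual (B.toClassical x)
  | .with' A B => .with' (A.toClassical x) (B.toClassical x)
  | .plus A B => .plus (A.toClassical x) (B.toClassical x)
  | .bang A => .bang (A.toClassical x)

theorem CProvable.of_eq {Γ Δ : Multiset (CFormula V)} (h : CProvable d Γ) (e : Γ = Δ) :
    CProvable d Δ := e ▸ h

theorem CProvable.swap {Γ : Multiset (CFormula V)} {A B : CFormula V}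
    (h : CProvable d (A ::ₘ B ::ₘ Γ)) : CProvable d (B ::ₘ A ::ₘ Γ) :=
  h.of_eq (Multiset.cons_swap _ _ _)

theorem CProvable.init_dual (A : CFormula V) : CProvable d (A.dual ::ₘ A ::ₘ 0) :=
  (CProvable.init A).swap

/-- Intuitionistic rules are two-sided forms of classical ones and are stable under substituting `⊥`
for `x`. -/
theorem IProvable.toClassical (x : V) {Γ : Multiset (IFormula V)} {C : IFormula V}
    (h : IProvable d Γ C) :
    CProvable d (C.toClassical x ::ₘ Γ.map fun A => (A.toClassical x).dual) := by
  induction h with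
  | init A => exact CProvable.init _
  | @cut _ Γ Δ A C _ _ ih₁ ih₂ =>
    rw [Multiset.map_cons] at ih₂
    exact (ih₁.cut ih₂.swap).of_eq (by simp)
  | oneR => exact CProvable.one
  | oneL _ ih => rw [Multiset.map_cons]; exact ih.bot.swap
  | topR Γ => exact CProvable.top _
  | zeroL Γ C => rw [Multiset.map_cons]; exact (CProvable.top _).swap
  | lolliL _ _ ih₁ ih₂ =>
    rw [Multiset.map_cons] at ih₂ ⊢
    simp only [IFormula.toClassical, CFormula.dual, CFormula.dual_dual]
    exact (ih₁.tensor ih₂.swap).of_eq (by simp [Multiset.cons_swap])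
  | lolliR _ ih =>
    rw [Multiset.map_cons] at ih
    exact ih.swap.par
  | @tensorL _ Γ A B C _ ih =>
    rw [Multiset.map_cons, Multiset.map_cons] at ih
    rw [Multiset.map_cons]
    refine CProvable.swap (CProvable.par ?_)
    refine ih.of_eq ?_
    simp only [← Multiset.singleton_add]; abel
  | tensorR _ _ ih₁ ih₂ => exact (ih₁.tensor ih₂).of_eq (by simp [IFormula.toClassical])
  | withL₁ _ ih =>
    rw [Multiset.map_cons] at ih ⊢
    exact ih.swap.plus₁.swap
  | withL₂ _ ih =>
    rw [Multiset.map_cons] at ih ⊢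
    exact ih.swap.plus₂.swap
  | withR _ _ ih₁ ih₂ => exact ih₁.with' ih₂
  | plusL _ _ ih₁ ih₂ =>
    rw [Multiset.map_cons] at ih₁ ih₂ ⊢
    exact (ih₁.swap.with' ih₂.swap).swap
  | plusR₁ _ ih => exact ih.plus₁
  | plusR₂ _ ih => exact ih.plus₂
  | weakening _ ih => rw [Multiset.map_cons]; exact ih.weakening.swap
  | @contraction _ Γ A C _ ih =>
    rw [Multiset.map_cons, Multiset.map_cons] at ih
    rw [Multiset.map_cons]
    refine CProvable.swap (CProvable.contraction ?_)
    refine ih.of_eq ?_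
    simp only [← Multiset.singleton_add, IFormula.toClassical, CFormula.dual]; abel
  | dereliction _ ih =>
    rw [Multiset.map_cons] at ih ⊢
    exact ih.swap.dereliction.swap
  | @promotion Γ A _ ih =>
    have e : (Γ.map IFormula.bang).map (fun A => (A.toClassical x).dual) =
        (Γ.map fun A => (A.toClassical x).dual).map CFormula.quest := by
      rw [Multiset.map_map, Multiset.map_map]; rfl
    rw [e] at ih ⊢
    exact ih.promotion
  | @functorial Γ A _ ih =>
    have e : (Γ.map IFormula.bang).map (fun A => (A.toClassical x).dual) =
        (Γ.map fun A => (A.toClassical x).dual).map CFormula.quest := by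
      rw [Multiset.map_map, Multiset.map_map]; rfl
    rw [e]
    exact ih.functorial

/-! ### Equivalence of the classical reading of `A^[x]` with `A^⊥`. -/

theorem CProvable.toClassical_negRel {x : V} {Γ : Multiset (CFormula V)} {A : IFormula V}
    (h : CProvable d ((A.toClassical x).dual ::ₘ Γ)) :
    CProvable d ((IFormula.negRel (.var x) A).toClassical x ::ₘ Γ) := by
  simp only [IFormula.negRel, IFormula.toClassical, if_true]
  exact h.bot.swap.par

theorem CProvable.toClassical_negRel_dual {x : V} {Γ : Multiset (CFormula V)} {A : IFormula V}
    (h : CProvable d (A.toClassical x ::ₘ Γ)) :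
    CProvable d (((IFormula.negRel (.var x) A).toClassical x).dual ::ₘ Γ) := by
  simp only [IFormula.negRel, IFormula.toClassical, if_true, CFormula.dual, CFormula.dual_dual]
  -- The dual of the reading of `A ⊸ x` is that of `A` tensored with `1`, and the factor `1` costs
  -- no context.
  exact (h.tensor (CProvable.one (V := V))).of_eq (by simp)

/-- Functoriality of `!` is the only exponential principle the equivalence uses, and both
disciplines have it. -/
theorem CProvable.bang_quest {A B : CFormula V} (h : CProvable d (A ::ₘ B ::ₘ 0)) :
    CProvable d (A.bang ::ₘ B.quest ::ₘ 0) := by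
  cases d
  · exact CProvable.promotion (Γ := {B}) h.swap.dereliction.swap
  · exact CProvable.functorial (Γ := {B}) h

/-- The classical reading of `A^[x]` is equivalent to `A^⊥`. -/
theorem toClassical_trans_equiv (d : Discipline) {x : V} {A : CFormula V} (hx : ¬ A.Occurs x) :
    CProvable d ((A.trans (.var x)).toClassical x ::ₘ A ::ₘ 0) ∧
      CProvable d (((A.trans (.var x)).toClassical x).dual ::ₘ A.dual ::ₘ 0) := by
  induction A with
  | pos p =>
    -- Freshness enters at the literals: as `p ≠ x`, the substitution leaves `p` alone.
    have e : (IFormula.var p).toClassical x = .pos p := if_neg hx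
    simp only [CFormula.trans]
    refine ⟨.toClassical_negRel ?_, .toClassical_negRel_dual ?_⟩ <;> rw [e]
    exacts [.init_dual _, .init _]
  | neg p =>
    have e : (IFormula.var p).toClassical x = .pos p := if_neg hx
    simp only [CFormula.trans, e]
    exact ⟨.init _, .init_dual _⟩
  | one => exact ⟨.toClassical_negRel (.init_dual _), .toClassical_negRel_dual (.init _)⟩
  | bot => exact ⟨.init _, .init_dual _⟩
  | top => exact ⟨.init _, .init_dual _⟩
  | zero => exact ⟨.toClassical_negRel (.init_dual _), .toClassical_negRel_dual (.init _)⟩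
  | tensor B C ihB ihC =>
    obtain ⟨b₁, b₂⟩ := ihB fun h => hx (.inl h)
    obtain ⟨c₁, c₂⟩ := ihC fun h => hx (.inr h)
    constructor
    · refine CProvable.par (.toClassical_negRel_dual ?_)
      exact (b₁.swap.tensor c₁.swap).of_eq (by
        simp only [← Multiset.singleton_add]; abel)
    · refine CProvable.swap (CProvable.par ?_)
      simp only [CFormula.trans, IFormula.toClassical, CFormula.dual, CFormula.dual_dual]
      exact (b₂.toClassical_negRel.tensor c₂).of_eq (by
        simp only [← Multiset.singleton_add]; abel)
  | par B C ihB ihC =>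
    obtain ⟨b₁, b₂⟩ := ihB fun h => hx (.inl h)
    obtain ⟨c₁, c₂⟩ := ihC fun h => hx (.inr h)
    constructor
    · refine CProvable.toClassical_negRel (CProvable.swap (CProvable.par ?_))
      simp only [IFormula.toClassical, CFormula.dual, CFormula.dual_dual]
      exact (b₁.tensor c₁.toClassical_negRel_dual).of_eq (by
        simp only [← Multiset.singleton_add]; abel)
    · refine CProvable.toClassical_negRel_dual (CProvable.par ?_)
      refine CProvable.swap (CProvable.toClassical_negRel ?_)
      exact (b₂.swap.tensor c₂.swap).of_eq (by
        simp only [← Multiset.singleton_add, CFormula.dual]; abel)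
  | with' B C ihB ihC =>
    obtain ⟨b₁, b₂⟩ := ihB fun h => hx (.inl h)
    obtain ⟨c₁, c₂⟩ := ihC fun h => hx (.inr h)
    exact ⟨(b₁.plus₁.swap.with' c₁.plus₂.swap).swap, b₂.swap.plus₁.swap.with' c₂.swap.plus₂.swap⟩
  | plus B C ihB ihC =>
    obtain ⟨b₁, b₂⟩ := ihB fun h => hx (.inl h)
    obtain ⟨c₁, c₂⟩ := ihC fun h => hx (.inr h)
    constructor
    · refine CProvable.toClassical_negRel (CProvable.with' ?_ ?_)
      · exact b₁.toClassical_negRel_dual.swap.plus₁.swap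
      · exact c₁.toClassical_negRel_dual.swap.plus₂.swap
    · refine CProvable.toClassical_negRel_dual (CProvable.swap (CProvable.with' ?_ ?_))
      · exact b₂.toClassical_negRel.plus₁.swap
      · exact c₂.toClassical_negRel.plus₂.swap
  | bang B ih =>
    obtain ⟨b₁, b₂⟩ := ih hx
    constructor
    · exact CProvable.toClassical_negRel b₁.toClassical_negRel_dual.swap.bang_quest.swap
    · exact CProvable.toClassical_negRel_dual b₂.toClassical_negRel.bang_quest
  | quest B ih =>
    obtain ⟨b₁, b₂⟩ := ih hx
    exact ⟨b₁.bang_quest, b₂.swap.bang_quest.swap⟩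

/-- Formulas are replaced one at a time by cuts against the equivalence; `Δ` collects those already
restored. -/
theorem CProvable.of_toClassical_trans {x : V} {Γ Δ : Multiset (CFormula V)}
    (hx : ∀ A ∈ Γ, ¬ A.Occurs x)
    (h : CProvable d (Γ.map (fun A => ((A.trans (.var x)).toClassical x).dual) + Δ)) :
    CProvable d (Γ + Δ) := by
  induction Γ using Multiset.induction_on generalizing Δ with
  | empty => simpa using h
  | cons A Γ ih =>
    have hA := (toClassical_trans_equiv d (hx A (Multiset.mem_cons_self A Γ))).1
    rw [Multiset.map_cons, Multiset.cons_add] at h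
    have := hA.cut h
    refine (@ih (A ::ₘ Δ) (fun B hB => hx B (Multiset.mem_cons_of_mem hB)) ?_).of_eq (by simp)
    exact this.of_eq (by simp)

theorem provable_iff_trans (d : Discipline) {Γ : Multiset (CFormula V)} {x : V}
    (hx : ∀ A ∈ Γ, ¬ A.Occurs x) :
    CProvable d Γ ↔ IProvable d (Γ.map (CFormula.trans (.var x))) (.var x) := by
  refine ⟨(cutFreeClosed_trans d (.var x)).mem_of_provable, fun h => ?_⟩
  have h := h.toClassical x
  have e : (IFormula.var x).toClassical x = .bot := if_pos rfl
  rw [e, Multiset.map_map] at h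
  -- The conclusion `x` is read as `⊥`, which is removed by a cut against the axiom for `1`.
  have h := (CProvable.one (d := d) (V := V)).cut (A := .one) (Γ := 0) h
  rw [zero_add] at h
  simpa using CProvable.of_toClassical_trans (Δ := 0) hx (by simpa using h)

end AffineLogic

theorem mainTheorem9 {V : Type*} (Γ : Multiset (AffineLogic.CFormula V)) (x : V)
    (hx : ∀ A ∈ Γ, ¬ A.Occurs x) :
    (AffineLogic.LLW Γ ↔
      AffineLogic.ILLW (Γ.map (AffineLogic.CFormula.trans (.var x))) (.var x)) ∧
    (AffineLogic.ELLW Γ ↔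
      AffineLogic.IELW (Γ.map (AffineLogic.CFormula.trans (.var x))) (.var x)) :=
  ⟨AffineLogic.provable_iff_trans _ hx, AffineLogic.provable_iff_trans _ hx⟩
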